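/- Let $\mathbb{C}_+=\{z\in\mathbb{C}:\operatorname{Im}z>0\}$. For a finite positive Borel measure $\mu$ on $\mathbb{R}$, its Poisson integral is $$P[\mu](x+iy)=\frac1\pi\int_{\mathbb{R}}\frac{y}{(x-u)^2+y^2}\,d\mu(u),\qquad x\in\mathbb{R},\ y>0.$$ (1) (Herglotz theorem for positive harmonic functions.) Let $U:\mathbb{C}_+\to[0,\infty)$ be harmonic (that is, $U\in C^2(\mathbb{C}_+)$ and $\Delta U=0$), and suppose that there is a constant $C$, independent of $x$ and $y$, such that $U(x+iy)\le \frac{C}{y}$ for all $x\in\mathbb{R}$, $y>0$. Then there exists a unique finite positive Borel measure $\mu$ on $\mathbb{R}$ such that $U=P[\mu]$ on $\mathbb{C}_+$. (2) (Herglotz theorem for holomorphic functions.) Let $f:\mathbb{C}_+\to\mathbb{C}_+\cup\mathbb{R}$ be holomorphic, and suppose that there is a constant $C$, independent of $x$ and $y$, such that $\operatorname{Im}f(x+iy)\le\frac{C}{y}$ for all $x\in\mathbb{R}$, $y>0$. Then there exist a unique finite positive Borel measure $\mu$ on $\mathbb{R}$ and a unique real number $a$ such that $$f(z)=\frac1\pi\int_{\mathbb{R}}\frac{d\mu(u)}{u-z}+a\qquad\text{for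 all }z\in\mathbb{C}_+.$$ -/

import Mathlib

open MeasureTheory

/-- The open upper half-plane, as a subset of `ℂ`. -/
def upperHalf : Set ℂ := {z : ℂ | 0 < z.im}

/-- The Poisson kernel of the upper half-plane, at height `y`. -/
noncomputable def poissonKernelHalf (y x : ℝ) : ℝ := (1 / Real.pi) * (y / (x ^ 2 + y ^ 2))

/-- The Poisson integral of a measure `μ` on the line, evaluated at `z = x + i y`. -/
noncomputable def poissonIntegral (μ : Measure ℝ) (z : ℂ) : ℝ :=
  ∫ u, poissonKernelHalf z.im (z.re - u) ∂μ

open Metric Filter Topology Complex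

/-! Existence: the discs of centre `i(R + 1/R)` and radius `R` lie in the half-plane and exhaust it.
On each, Poisson's formula expresses `U` through its values on the circle. Dividing the boundary
measure by `1 + |ζ|²` gives finite measures `ρ_R` with `∫ (1 + |ζ|²) dρ_R = 2πR U(i(R + 1/R)) ≤
2πC`. This moment bound makes them tight, so they have a weak limit `ν`, which lives on the real
line; the disc kernels tend to the half-plane kernel, and `μ` is `(1 + |ζ|²) ν` carried to `ℝ`.
Uniqueness: the Poisson kernel is an approximate identity, so `P[μ](· + iy) dx` tends weakly to `μ`
as `y → 0`. For holomorphic `f`, represent `Im f`; the Cauchy transform of `μ` differs from `f` by a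
function with zero imaginary part, a real constant by the open mapping theorem. -/

/-! ### Approximate identity and uniqueness -/

theorem continuous_poissonKernelHalf {y : ℝ} (hy : 0 < y) : Continuous (poissonKernelHalf y) := by
  unfold poissonKernelHalf
  exact continuous_const.mul (continuous_const.div (by fun_prop) fun x ↦ by positivity)

theorem poissonKernelHalf_smul {y : ℝ} (hy : 0 < y) (s : ℝ) :
    y * poissonKernelHalf y (y * s) = Real.pi⁻¹ * (1 + s ^ 2)⁻¹ := by
  unfold poissonKernelHalf
  have : (0 : ℝ) < 1 + s ^ 2 := by positivity
  have h2 : (y * s) ^ 2 + y ^ 2 = y ^ 2 * (1 + s ^ 2) := by ring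
  rw [h2]
  field_simp

theorem integrable_poissonKernelHalf {y : ℝ} (hy : 0 < y) : Integrable (poissonKernelHalf y) := by
  rw [← integrable_comp_mul_left_iff _ hy.ne']
  have h := (integrable_inv_one_add_sq.const_mul Real.pi⁻¹).const_mul y⁻¹
  refine h.congr (Eventually.of_forall fun s ↦ ?_)
  simp only [← poissonKernelHalf_smul hy s]
  field_simp

/-- The substitution `x = u + ys` moves the dependence on `y` from the kernel into `g`, leaving a
fixed dominating density. -/
theorem integral_mul_poissonKernelHalf {y : ℝ} (hy : 0 < y) (g : ℝ → ℝ) (u : ℝ) :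
    ∫ x, g x * poissonKernelHalf y (x - u) =
      ∫ s, g (u + y * s) * (Real.pi⁻¹ * (1 + s ^ 2)⁻¹) := by
  rw [← integral_add_right_eq_self _ u]
  have h := Measure.integral_comp_mul_left
    (fun t ↦ g (t + u) * poissonKernelHalf y (t + u - u)) y
  rw [abs_of_pos (inv_pos.2 hy), smul_eq_mul, eq_inv_mul_iff_mul_eq₀ hy.ne'] at h
  rw [← h, ← integral_const_mul]
  refine integral_congr_ae (Eventually.of_forall fun s ↦ ?_)
  simp only [← poissonKernelHalf_smul hy s, add_sub_cancel_right, add_comm u]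
  ring

theorem integral_mul_poissonIntegral (μ : Measure ℝ) [IsFiniteMeasure μ] {y : ℝ} (hy : 0 < y)
    (g : BoundedContinuousFunction ℝ ℝ) :
    ∫ x : ℝ, g x * poissonIntegral μ (x + y * I) =
      ∫ u, (∫ s, g (u + y * s) * (Real.pi⁻¹ * (1 + s ^ 2)⁻¹)) ∂μ := by
  simp_rw [← integral_mul_poissonKernelHalf hy]
  have hint : Integrable (fun p : ℝ × ℝ ↦ g p.1 * poissonKernelHalf y (p.1 - p.2))
      (volume.prod μ) := by
    have hmeas : AEStronglyMeasurable (fun p : ℝ × ℝ ↦ poissonKernelHalf y (p.1 - p.2))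
        (volume.prod μ) :=
      ((continuous_poissonKernelHalf hy).comp (by fun_prop)).aestronglyMeasurable
    refine Integrable.bdd_mul (c := ‖g‖) ?_ (by fun_prop)
      (Eventually.of_forall fun p ↦ g.norm_coe_le_norm p.1)
    refine (integrable_prod_iff' hmeas).2 ⟨Eventually.of_forall fun u ↦
      (integrable_poissonKernelHalf hy).comp_sub_right u, ?_⟩
    have : ∀ u, ∫ x, ‖poissonKernelHalf y (x - u)‖ = ∫ x, ‖poissonKernelHalf y x‖ := fun u ↦
      integral_sub_right_eq_self (fun x ↦ ‖poissonKernelHalf y x‖) u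
    simp_rw [this]
    exact integrable_const _
  rw [← integral_integral_swap (f := fun x u ↦ g x * poissonKernelHalf y (x - u)) hint]
  refine integral_congr_ae (Eventually.of_forall fun x ↦ ?_)
  simp [poissonIntegral, integral_const_mul]

theorem tendsto_integral_mul_poissonIntegral (μ : Measure ℝ) [IsFiniteMeasure μ]
    (g : BoundedContinuousFunction ℝ ℝ) :
    Tendsto (fun n : ℕ ↦ ∫ x : ℝ, g x * poissonIntegral μ (x + (1 / ((n : ℝ) + 1) : ℝ) * I)) atTop
      (𝓝 (∫ u, g u ∂μ)) := by
  simp_rw [integral_mul_poissonIntegral μ (Nat.one_div_pos_of_nat (α := ℝ))]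
  have hk : Integrable fun s : ℝ ↦ Real.pi⁻¹ * (1 + s ^ 2)⁻¹ :=
    integrable_inv_one_add_sq.const_mul _
  have hk1 : ∫ s : ℝ, Real.pi⁻¹ * (1 + s ^ 2)⁻¹ = 1 := by
    rw [integral_const_mul, integral_univ_inv_one_add_sq, inv_mul_cancel₀ Real.pi_ne_zero]
  have hb : ∀ (y u s : ℝ), ‖g (u + y * s) * (Real.pi⁻¹ * (1 + s ^ 2)⁻¹)‖ ≤
      ‖g‖ * (Real.pi⁻¹ * (1 + s ^ 2)⁻¹) := fun y u s ↦ by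
    rw [norm_mul, Real.norm_of_nonneg (by positivity : 0 ≤ Real.pi⁻¹ * (1 + s ^ 2)⁻¹)]
    gcongr
    exact g.norm_coe_le_norm _
  refine tendsto_integral_of_dominated_convergence (fun _ ↦ ‖g‖) (fun n ↦ ?_)
    (integrable_const _) (fun n ↦ Eventually.of_forall fun u ↦ ?_)
    (Eventually.of_forall fun u ↦ ?_)
  · refine Measurable.aestronglyMeasurable (StronglyMeasurable.measurable ?_)
    refine StronglyMeasurable.integral_prod_right'
      (f := fun p : ℝ × ℝ ↦ g (p.1 + _ * p.2) * (Real.pi⁻¹ * (1 + p.2 ^ 2)⁻¹)) ?_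
    refine Measurable.stronglyMeasurable ?_
    have := g.continuous.measurable
    fun_prop
  · refine (norm_integral_le_of_norm_le (hk.const_mul ‖g‖) (Eventually.of_forall (hb _ u))).trans ?_
    rw [integral_const_mul, hk1, mul_one]
  · have hlim : ∫ s : ℝ, g u * (Real.pi⁻¹ * (1 + s ^ 2)⁻¹) = g u := by
      rw [integral_const_mul, hk1, mul_one]
    rw [← hlim]
    refine tendsto_integral_of_dominated_convergence _ (fun n ↦ ?_)
      (hk.const_mul ‖g‖) (fun n ↦ Eventually.of_forall (hb _ u))
      (Eventually.of_forall fun s ↦ ?_)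
    · have := g.continuous.measurable
      exact Measurable.aestronglyMeasurable (by fun_prop)
    · refine Tendsto.mul_const _ ((g.continuous.tendsto u).comp ?_)
      simpa using (tendsto_one_div_add_atTop_nhds_zero_nat (𝕜 := ℝ)).mul_const s |>.const_add u

theorem eq_of_poissonIntegral_eq {μ ν : Measure ℝ} [IsFiniteMeasure μ] [IsFiniteMeasure ν]
    (h : ∀ z ∈ upperHalf, poissonIntegral μ z = poissonIntegral ν z) : μ = ν := by
  refine ext_of_forall_integral_eq_of_IsFiniteMeasure fun g ↦ ?_
  refine tendsto_nhds_unique (tendsto_integral_mul_poissonIntegral μ g)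
    ((tendsto_integral_mul_poissonIntegral ν g).congr fun n ↦ ?_)
  refine integral_congr_ae (Eventually.of_forall fun x ↦ ?_)
  simp only
  rw [h]
  simp only [upperHalf, Set.mem_ofPred_eq, add_im, ofReal_im, mul_im, ofReal_re, I_im, mul_one,
    I_re, mul_zero, add_zero, zero_add]
  exact Nat.one_div_pos_of_nat

/-! ### The Cauchy transform of a finite measure -/

theorem isOpen_upperHalf : IsOpen upperHalf := isOpen_lt continuous_const continuous_im

theorem isPreconnected_upperHalf : IsPreconnected upperHalf :=
  (convex_halfSpace_im_gt 0).isPreconnected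

theorem I_mem_upperHalf : I ∈ upperHalf := by simp [upperHalf]

theorem im_le_norm_ofReal_sub {z : ℂ} (u : ℝ) : z.im ≤ ‖(u : ℂ) - z‖ := by
  have := (neg_le_abs _).trans (abs_im_le_norm ((u : ℂ) - z))
  simpa using this

theorem ofReal_sub_ne_zero {z : ℂ} (hz : z ∈ upperHalf) (u : ℝ) : (u : ℂ) - z ≠ 0 :=
  norm_pos_iff.1 (lt_of_lt_of_le hz (im_le_norm_ofReal_sub u))

theorem integrable_one_div_ofReal_sub (μ : Measure ℝ) [IsFiniteMeasure μ] {z : ℂ}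
    (hz : z ∈ upperHalf) : Integrable (fun u : ℝ ↦ 1 / ((u : ℂ) - z)) μ := by
  refine Integrable.of_bound (C := 1 / z.im) ?_ (Eventually.of_forall fun u ↦ ?_)
  · exact (by fun_prop : Measurable fun u : ℝ ↦ 1 / ((u : ℂ) - z)).aestronglyMeasurable
  · rw [norm_div, norm_one]
    exact one_div_le_one_div_of_le hz (im_le_norm_ofReal_sub u)

theorem differentiableOn_integral_one_div_ofReal_sub (μ : Measure ℝ) [IsFiniteMeasure μ] :
    DifferentiableOn ℂ (fun z ↦ ∫ u : ℝ, 1 / ((u : ℂ) - z) ∂μ) upperHalf := by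
  intro z hz
  have hz' : 0 < z.im := hz
  have hs : {w : ℂ | z.im / 2 < w.im} ∈ 𝓝 z :=
    (isOpen_lt continuous_const continuous_im).mem_nhds (half_lt_self hz')
  refine (hasDerivAt_integral_of_dominated_loc_of_deriv_le (μ := μ)
    (F := fun w (u : ℝ) ↦ 1 / ((u : ℂ) - w)) (F' := fun w (u : ℝ) ↦ 1 / ((u : ℂ) - w) ^ 2)
    (bound := fun _ ↦ 1 / (z.im / 2) ^ 2) hs
    (Eventually.of_forall fun w ↦ Measurable.aestronglyMeasurable (by fun_prop))
    (integrable_one_div_ofReal_sub μ hz) (Measurable.aestronglyMeasurable (by fun_prop))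
    (Eventually.of_forall fun u w hw ↦ ?_) (integrable_const _)
    (Eventually.of_forall fun u w hw ↦ ?_)).2.differentiableAt.differentiableWithinAt
  · rw [norm_div, norm_one, norm_pow]
    have : z.im / 2 < w.im := hw
    have := im_le_norm_ofReal_sub (z := w) u
    gcongr
    linarith
  · have hne := ofReal_sub_ne_zero (z := w) ((half_pos hz').trans hw) u
    have h := ((hasDerivAt_id w).const_sub (u : ℂ)).fun_inv hne
    simpa [one_div] using h

theorem im_integral_one_div_ofReal_sub (μ : Measure ℝ) [IsFiniteMeasure μ] {z : ℂ}
    (hz : z ∈ upperHalf) :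
    ((1 / (Real.pi : ℂ)) * ∫ u : ℝ, 1 / ((u : ℂ) - z) ∂μ).im = poissonIntegral μ z := by
  have h : (1 / (Real.pi : ℂ)) = ((1 / Real.pi : ℝ) : ℂ) := by push_cast; rfl
  have him := imCLM.integral_comp_comm (integrable_one_div_ofReal_sub μ hz)
  simp only [imCLM_apply] at him
  rw [h, im_ofReal_mul, ← him, poissonIntegral, ← integral_const_mul]
  refine integral_congr_ae (Eventually.of_forall fun u ↦ ?_)
  simp only [poissonKernelHalf, one_div, inv_im, normSq_apply, sub_im, ofReal_im, sub_re,
    ofReal_re]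
  congr 1
  rw [zero_sub, neg_neg]
  congr 1
  ring

theorem exists_ofReal_eq_of_im_eq_zero {h : ℂ → ℂ} (hd : DifferentiableOn ℂ h upperHalf)
    (him : ∀ z ∈ upperHalf, (h z).im = 0) : ∃ a : ℝ, ∀ z ∈ upperHalf, h z = a := by
  rcases (hd.analyticOnNhd isOpen_upperHalf).is_constant_or_isOpen isPreconnected_upperHalf with
    ⟨w, hw⟩ | ho
  · refine ⟨w.re, fun z hz ↦ ?_⟩
    have := him z hz
    rw [hw z hz] at this ⊢
    exact Complex.ext (by simp) (by simp [this])
  · have h1 := ho upperHalf subset_rfl isOpen_upperHalf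
    -- An open image inside the closed lower half-plane lies in its interior, where the imaginary
    -- part is negative.
    have h2 : h I ∈ interior {w : ℂ | w.im ≤ 0} := by
      refine mem_interior.2 ⟨_, ?_, h1, Set.mem_image_of_mem _ I_mem_upperHalf⟩
      rintro _ ⟨z, hz, rfl⟩
      exact (him z hz).le
    rw [interior_setOfPred_im_le] at h2
    exact absurd (him I I_mem_upperHalf) (ne_of_lt h2)

/-! ### Weighted boundary measures on circles and tightness -/

theorem exists_finiteMeasure_integral_eq_circleAverage {w : ℂ → ℝ} {c : ℂ} {R : ℝ} (hR : 0 ≤ R)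
    (hw : ContinuousOn w (sphere c R)) (h0 : ∀ z ∈ sphere c R, 0 ≤ w z) :
    ∃ ρ : FiniteMeasure ℂ, (∀ᵐ z ∂(ρ : Measure ℂ), z ∈ sphere c R) ∧
      ∀ g : ℂ → ℝ, Measurable g →
        ∫ z, g z ∂(ρ : Measure ℂ) = Real.circleAverage (fun z ↦ w z * g z) c R := by
  have hγ : Continuous (circleMap c R) := continuous_circleMap c R
  have hmem : ∀ θ, circleMap c R θ ∈ sphere c R := fun θ ↦ circleMap_mem_sphere c hR θ
  have hd : Continuous fun θ ↦ (2 * Real.pi)⁻¹ * w (circleMap c R θ) :=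
    continuous_const.mul (hw.comp_continuous hγ hmem)
  have hd0 : ∀ θ, 0 ≤ (2 * Real.pi)⁻¹ * w (circleMap c R θ) :=
    fun θ ↦ mul_nonneg (by positivity) (h0 _ (hmem θ))
  let κ : Measure ℝ := (volume.restrict (Set.Ioc 0 (2 * Real.pi))).withDensity
    (fun θ ↦ ENNReal.ofReal ((2 * Real.pi)⁻¹ * w (circleMap c R θ)))
  have : IsFiniteMeasure κ :=
    isFiniteMeasure_withDensity_ofReal (hd.integrableOn_Ioc (a := 0) (b := 2 * Real.pi)).2
  refine ⟨⟨κ.map (circleMap c R), inferInstance⟩, ?_, fun g hg ↦ ?_⟩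
  · exact (ae_map_iff hγ.aemeasurable isClosed_sphere.measurableSet).2 (Eventually.of_forall hmem)
  · rw [FiniteMeasure.toMeasure_mk, integral_map hγ.aemeasurable hg.aestronglyMeasurable,
      integral_withDensity_eq_integral_toReal_smul hd.measurable.ennreal_ofReal (by simp),
      Real.circleAverage_def, intervalIntegral.integral_of_le (by positivity), smul_eq_mul,
      ← integral_const_mul]
    refine integral_congr_ae (Eventually.of_forall fun θ ↦ ?_)
    simp only [ENNReal.toReal_ofReal (hd0 θ), smul_eq_mul]
    ring

theorem exists_ultrafilter_tendsto_of_integral_one_add_sq_le {ρ : ℕ → FiniteMeasure ℂ} {M : ℝ}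
    (hint : ∀ n, Integrable (fun z : ℂ ↦ 1 + ‖z‖ ^ 2) (ρ n : Measure ℂ))
    (hM : ∀ n, ∫ z, (1 + ‖z‖ ^ 2) ∂(ρ n : Measure ℂ) ≤ M) :
    ∃ (f : Ultrafilter ℕ) (ν : FiniteMeasure ℂ), (f : Filter ℕ) ≤ atTop ∧
      Tendsto ρ f (𝓝 ν) := by
  have hu : Tendsto (fun n : ℕ ↦ (M / (1 + (n : ℝ) ^ 2)).toNNReal) atTop (𝓝 0) := by
    rw [← Real.toNNReal_zero]
    refine (continuous_real_toNNReal.tendsto 0).comp (Tendsto.const_div_atTop ?_ M)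
    exact tendsto_atTop_add_const_left _ _
      ((tendsto_pow_atTop two_ne_zero).comp tendsto_natCast_atTop_atTop)
  have hK := isCompact_setOfPred_finiteMeasure_mass_le_compl_isCompact_le M.toNNReal hu
    (fun n : ℕ ↦ isCompact_closedBall (0 : ℂ) n) (Or.inl inferInstance)
  -- Markov's inequality; `r = 1` bounds the mass, `r = 1 + m²` the mass outside the ball of radius
  -- `m`.
  have key : ∀ n, ∀ s : Set ℂ, ∀ r : ℝ, 0 < r → (∀ z ∈ s, r ≤ 1 + ‖z‖ ^ 2) →
      ρ n s ≤ (M / r).toNNReal := by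
    intro n s r hr hs
    have h1 := mul_meas_ge_le_integral_of_nonneg
      (Eventually.of_forall fun z : ℂ ↦ (by positivity : (0 : ℝ) ≤ 1 + ‖z‖ ^ 2)) (hint n) r
    have h2 : (ρ n : Measure ℂ).real s ≤ (ρ n : Measure ℂ).real {z | r ≤ 1 + ‖z‖ ^ 2} :=
      measureReal_mono hs
    have h3 : (ρ n : Measure ℂ).real s ≤ M / r := by
      rw [le_div_iff₀ hr]
      nlinarith [hM n]
    exact NNReal.le_toNNReal_of_coe_le h3
  obtain ⟨ν, -, hν⟩ := hK.ultrafilter_le_nhds' ((Ultrafilter.of atTop).map ρ) (by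
    rw [Ultrafilter.mem_map]
    refine Eventually.of_forall fun n ↦ ⟨?_, fun m ↦ ?_⟩
    · simpa using key n Set.univ 1 one_pos (fun z _ ↦ by nlinarith [sq_nonneg ‖z‖])
    · refine key n _ _ (by positivity) fun z hz ↦ ?_
      have : (m : ℝ) < ‖z‖ := by simpa using hz
      gcongr)
  exact ⟨Ultrafilter.of atTop, ν, Ultrafilter.of_le _, hν⟩

theorem norm_sub_ofReal_mul_I_sq (z : ℂ) (a : ℝ) :
    ‖z - a * I‖ ^ 2 = ‖z‖ ^ 2 - 2 * a * z.im + a ^ 2 := by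
  simp only [← normSq_eq_norm_sq, normSq_apply, sub_re, sub_im, mul_re, mul_im, ofReal_re,
    ofReal_im, I_re, I_im]
  ring

theorem closedBall_subset_upperHalf {a R : ℝ} (h : R < a) :
    closedBall (a * I) R ⊆ upperHalf := by
  intro z hz
  have h1 := (abs_im_le_norm (z - a * I)).trans (mem_closedBall_iff_norm.1 hz)
  have h2 := (abs_le.1 h1).1
  simp only [sub_im, mul_im, ofReal_re, I_im, mul_one, ofReal_im, I_re, mul_zero, add_zero] at h2
  simp only [upperHalf, Set.mem_ofPred_eq]
  linarith

theorem exists_finiteMeasure_circle_poisson {U : ℂ → ℝ} {C : ℝ}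
    (hU : InnerProductSpace.HarmonicOnNhd U upperHalf) (h0 : ∀ z ∈ upperHalf, 0 ≤ U z)
    (hC : ∀ z ∈ upperHalf, U z ≤ C / z.im) {a R : ℝ} (hR : 0 < R) (ha : R < a) :
    ∃ ρ : FiniteMeasure ℂ, (∀ᵐ z ∂(ρ : Measure ℂ), z ∈ sphere (a * I : ℂ) R) ∧
      ∫ z, (1 + ‖z‖ ^ 2) ∂(ρ : Measure ℂ) ≤ 2 * Real.pi * C ∧
      ∀ z ∈ ball (a * I : ℂ) R, U z = (R ^ 2 - ‖z - a * I‖ ^ 2) / (2 * R) *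
        (Real.pi⁻¹ * ∫ ζ, (1 + ‖ζ‖ ^ 2) / ‖ζ - z‖ ^ 2 ∂(ρ : Measure ℂ)) := by
  have hsub := closedBall_subset_upperHalf ha
  have hsph : sphere (a * I : ℂ) R ⊆ upperHalf := sphere_subset_closedBall.trans hsub
  have hpos : ∀ ζ : ℂ, 0 < 1 + ‖ζ‖ ^ 2 := fun ζ ↦ by positivity
  obtain ⟨ρ, hρ, hint⟩ := exists_finiteMeasure_integral_eq_circleAverage
    (w := fun ζ ↦ 2 * Real.pi * R * U ζ / (1 + ‖ζ‖ ^ 2)) (c := a * I) hR.le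
    ((continuousOn_const.mul (hU.continuousOn.mono hsph)).div (by fun_prop)
      fun ζ _ ↦ (hpos ζ).ne')
    (fun ζ hζ ↦ div_nonneg (mul_nonneg (by positivity) (h0 ζ (hsph hζ))) (hpos ζ).le)
  refine ⟨ρ, hρ, ?_, fun z hz ↦ ?_⟩
  · rw [hint _ (by fun_prop)]
    have h1 : Real.circleAverage (fun ζ ↦ 2 * Real.pi * R * U ζ / (1 + ‖ζ‖ ^ 2) * (1 + ‖ζ‖ ^ 2))
        (a * I) R = 2 * Real.pi * R * U (a * I) := by
      rw [← InnerProductSpace.HarmonicOnNhd.circleAverage_eq (R := R)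
        (hU.mono (by rwa [abs_of_pos hR])), ← smul_eq_mul (2 * Real.pi * R), ← Real.circleAverage_smul]
      congr 1
      ext ζ
      have := (hpos ζ).ne'
      simp only [Pi.smul_apply, smul_eq_mul]
      field_simp
    have hmem : (a * I : ℂ) ∈ upperHalf := hsub (mem_closedBall_self hR.le)
    have hC0 := hC _ hmem
    have hU0 := h0 _ hmem
    have him : (a * I : ℂ).im = a := by simp
    rw [him] at hC0
    rw [h1, mul_assoc]
    have : 0 < a := hR.trans ha
    rw [le_div_iff₀ this] at hC0
    -- `R U(ia) ≤ a U(ia) ≤ C`, as `R < a` and `U ≥ 0`.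
    have : R * U (a * I) ≤ C := by nlinarith
    gcongr
  · rw [hint _ (by fun_prop),
      ← InnerProductSpace.HarmonicOnNhd.circleAverage_poissonKernel_smul (hU.mono hsub) hz,
      ← mul_assoc, ← smul_eq_mul ((R ^ 2 - ‖z - a * I‖ ^ 2) / (2 * R) * Real.pi⁻¹),
      ← Real.circleAverage_smul]
    refine Real.circleAverage_congr_sphere fun ζ hζ ↦ ?_
    rw [abs_of_pos hR] at hζ
    have h1 : ‖ζ - a * I‖ = R := by simpa using hζ
    have h2 := (hpos ζ).ne'
    simp only [Pi.smul_apply, Pi.smul_apply', smul_eq_mul, poissonKernel_def, h1,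
      sub_sub_sub_cancel_right]
    have := Real.pi_ne_zero
    rcases eq_or_ne ‖ζ - z‖ 0 with h3 | h3
    · simp [h3]
    · field_simp

/-- A bounded continuous modification, away from `z`, of `ζ ↦ (1 + |ζ|²) / |ζ - z|²`. -/
noncomputable def truncatedKernel (z : ℂ) (δ : ℝ) (hδ : 0 < δ) :
    BoundedContinuousFunction ℂ ℝ :=
  BoundedContinuousFunction.ofNormedAddCommGroup
    (fun ζ ↦ (1 + ‖ζ‖ ^ 2) / max (‖ζ - z‖ ^ 2) (δ ^ 2))
    (Continuous.div (by fun_prop) (by fun_prop) fun ζ ↦ by positivity)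
    ((1 + 2 * ‖z‖ ^ 2) / δ ^ 2 + 2) fun ζ ↦ by
      have hm : 0 < max (‖ζ - z‖ ^ 2) (δ ^ 2) := by positivity
      rw [Real.norm_of_nonneg (by positivity), div_le_iff₀ hm, add_mul]
      have h1 : ‖ζ‖ ≤ ‖ζ - z‖ + ‖z‖ := norm_le_norm_sub_add ζ z
      have h2 : 1 + 2 * ‖z‖ ^ 2 ≤
          (1 + 2 * ‖z‖ ^ 2) / δ ^ 2 * max (‖ζ - z‖ ^ 2) (δ ^ 2) := by
        rw [div_mul_eq_mul_div, le_div_iff₀ (by positivity)]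
        gcongr
        exact le_max_right _ _
      have h3 := le_max_left (‖ζ - z‖ ^ 2) (δ ^ 2)
      have h4 : ‖ζ‖ ^ 2 ≤ (‖ζ - z‖ + ‖z‖) ^ 2 := by gcongr
      nlinarith [sq_nonneg (‖ζ - z‖ - ‖z‖)]

theorem truncatedKernel_apply (z : ℂ) {δ : ℝ} (hδ : 0 < δ) (ζ : ℂ) :
    truncatedKernel z δ hδ ζ = (1 + ‖ζ‖ ^ 2) / max (‖ζ - z‖ ^ 2) (δ ^ 2) := rfl

theorem truncatedKernel_of_le {z ζ : ℂ} {δ : ℝ} (hδ : 0 < δ) (h : δ ≤ ‖ζ - z‖) :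
    truncatedKernel z δ hδ ζ = (1 + ‖ζ‖ ^ 2) / ‖ζ - z‖ ^ 2 := by
  rw [truncatedKernel_apply, max_eq_left (by gcongr)]

/-- Weak convergence bounds the integrals of the truncations `min (1 + |z|²) k` by `M`; monotone
convergence in `k` concludes. -/
theorem integrable_one_add_sq_of_tendsto {ι : Type*} {f : Filter ι} [f.NeBot]
    {ρ : ι → FiniteMeasure ℂ} {ν : FiniteMeasure ℂ} (hν : Tendsto ρ f (𝓝 ν)) {M : ℝ}
    (hint : ∀ n, Integrable (fun z : ℂ ↦ 1 + ‖z‖ ^ 2) (ρ n : Measure ℂ))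
    (hM : ∀ n, ∫ z, (1 + ‖z‖ ^ 2) ∂(ρ n : Measure ℂ) ≤ M) :
    Integrable (fun z : ℂ ↦ 1 + ‖z‖ ^ 2) (ν : Measure ℂ) := by
  let b : ℕ → BoundedContinuousFunction ℂ ℝ := fun k ↦
    BoundedContinuousFunction.ofNormedAddCommGroup (fun z ↦ min (1 + ‖z‖ ^ 2) k) (by fun_prop) k
      fun z ↦ by
        rw [Real.norm_of_nonneg (by positivity)]
        exact min_le_right _ _
  have hb0 : ∀ k z, 0 ≤ b k z := fun k z ↦ le_min (by positivity) (Nat.cast_nonneg k)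
  have hb : ∀ k, ∫ z, b k z ∂(ν : Measure ℂ) ≤ M := fun k ↦
    le_of_tendsto (FiniteMeasure.tendsto_iff_forall_integral_tendsto.1 hν (b k))
      (Eventually.of_forall fun n ↦ (integral_mono ((b k).integrable _) (hint n)
        fun z ↦ min_le_left _ _).trans (hM n))
  refine ⟨by fun_prop, ?_⟩
  rw [hasFiniteIntegral_iff_ofReal (Eventually.of_forall fun z ↦ by positivity)]
  have hsup : ∀ z : ℂ, ENNReal.ofReal (1 + ‖z‖ ^ 2) = ⨆ k, ENNReal.ofReal (b k z) := by
    intro z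
    refine le_antisymm ?_ (iSup_le fun k ↦ ENNReal.ofReal_le_ofReal (min_le_left _ _))
    obtain ⟨k, hk⟩ := exists_nat_ge (1 + ‖z‖ ^ 2)
    exact le_iSup_of_le k (ENNReal.ofReal_le_ofReal (le_min le_rfl hk))
  simp_rw [hsup]
  rw [lintegral_iSup (fun k ↦ (b k).continuous.measurable.ennreal_ofReal)
    fun k l hkl z ↦ ENNReal.ofReal_le_ofReal (min_le_min_left _ (Nat.cast_le.2 hkl))]
  refine (iSup_le fun k ↦ ?_).trans_lt (ENNReal.ofReal_lt_top (r := M))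
  rw [← ofReal_integral_eq_lintegral_ofReal ((b k).integrable _) (Eventually.of_forall (hb0 k))]
  exact ENNReal.ofReal_le_ofReal (hb k)

/-! ### Geometry of the exhausting discs -/

/-- On the circle, `2(R + 1/R) Im ζ = |ζ|² + 2 + R⁻²`, at most `3(1 + |ζ|²)`. This decay forces the
weak limit onto the real line. -/
theorem im_le_of_mem_sphere {R : ℝ} (hR : 1 ≤ R) {ζ : ℂ}
    (hζ : ζ ∈ sphere ((R + R⁻¹ : ℝ) * I : ℂ) R) :
    0 ≤ ζ.im ∧ ζ.im / (1 + ‖ζ‖ ^ 2) ≤ 3 / 2 * R⁻¹ := by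
  have hR0 : 0 < R := by positivity
  have hi : R * R⁻¹ = 1 := mul_inv_cancel₀ hR0.ne'
  have hi0 : 0 < R⁻¹ := inv_pos.2 hR0
  have hi1 : R⁻¹ ≤ 1 := inv_le_one_of_one_le₀ hR
  have h := norm_sub_ofReal_mul_I_sq ζ (R + R⁻¹)
  rw [mem_sphere_iff_norm.1 hζ] at h
  have h1 : 2 * (R + R⁻¹) * ζ.im = ‖ζ‖ ^ 2 + 2 + R⁻¹ ^ 2 := by linear_combination h + 2 * hi
  have h0 : 0 ≤ ζ.im := by
    by_contra! hneg
    nlinarith [sq_nonneg ‖ζ‖, sq_nonneg R⁻¹]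
  refine ⟨h0, ?_⟩
  rw [div_le_iff₀ (by positivity)]
  have h2 : 2 * R * ζ.im ≤ 3 * (1 + ‖ζ‖ ^ 2) := by nlinarith [sq_nonneg ‖ζ‖]
  calc ζ.im = R⁻¹ / 2 * (2 * R * ζ.im) := by linear_combination -ζ.im * hi
    _ ≤ R⁻¹ / 2 * (3 * (1 + ‖ζ‖ ^ 2)) := by gcongr
    _ = _ := by ring

theorem tendsto_sq_sub_norm_sub_sq_div (z : ℂ) :
    Tendsto (fun R : ℝ ↦ (R ^ 2 - ‖z - (R + R⁻¹ : ℝ) * I‖ ^ 2) / (2 * R)) atTop (𝓝 z.im) := by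
  have h : Tendsto (fun R : ℝ ↦
      (1 + R⁻¹ ^ 2) * z.im - R⁻¹ * ((‖z‖ ^ 2 + 2 + R⁻¹ ^ 2) / 2)) atTop
      (𝓝 ((1 + 0 ^ 2) * z.im - 0 * ((‖z‖ ^ 2 + 2 + 0 ^ 2) / 2))) := by
    have := tendsto_inv_atTop_zero (𝕜 := ℝ)
    exact (((this.pow 2).const_add 1).mul_const _).sub
      (this.mul (((this.pow 2).const_add _).div_const 2))
  rw [show (1 + 0 ^ 2) * z.im - 0 * ((‖z‖ ^ 2 + 2 + 0 ^ 2) / 2) = z.im by ring] at h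
  refine h.congr' ?_
  filter_upwards [eventually_gt_atTop 0] with R hR
  rw [norm_sub_ofReal_mul_I_sq]
  field_simp
  ring

/-- `(R² - |z - c|²)/(2R) ≤ R - |z - c| ≤ |ζ - z|`, since `R + |z - c| ≤ 2R`. -/
theorem le_norm_sub_of_mem_sphere {c ζ z : ℂ} {R δ : ℝ} (hz : z ∈ ball c R) (hζ : ζ ∈ sphere c R)
    (h : δ ≤ (R ^ 2 - ‖z - c‖ ^ 2) / (2 * R)) : δ ≤ ‖ζ - z‖ := by
  have h1 : ‖z - c‖ < R := mem_ball_iff_norm.1 hz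
  have h2 : ‖ζ - c‖ = R := mem_sphere_iff_norm.1 hζ
  have h3 : ‖ζ - c‖ ≤ ‖ζ - z‖ + ‖z - c‖ := norm_sub_le_norm_sub_add_norm_sub ζ z c
  have h4 := norm_nonneg (z - c)
  refine h.trans ?_
  rw [div_le_iff₀ (by linarith)]
  nlinarith

/-! ### Passage to the limit -/

theorem exists_finiteMeasure_complex_of_harmonic {U : ℂ → ℝ} {C : ℝ}
    (hU : InnerProductSpace.HarmonicOnNhd U upperHalf) (h0 : ∀ z ∈ upperHalf, 0 ≤ U z)
    (hC : ∀ z ∈ upperHalf, U z ≤ C / z.im) :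
    ∃ ν : FiniteMeasure ℂ, (∀ᵐ ζ ∂(ν : Measure ℂ), ζ.im = 0) ∧
      Integrable (fun ζ : ℂ ↦ 1 + ‖ζ‖ ^ 2) (ν : Measure ℂ) ∧
      ∀ z ∈ upperHalf, U z =
        z.im * (Real.pi⁻¹ * ∫ ζ, (1 + ‖ζ‖ ^ 2) / ‖ζ - z‖ ^ 2 ∂(ν : Measure ℂ)) := by
  have hR1 : ∀ n : ℕ, (1 : ℝ) ≤ n + 1 := fun n ↦ by linarith [n.cast_nonneg (α := ℝ)]
  have hR0 : ∀ n : ℕ, (0 : ℝ) < n + 1 := fun n ↦ by positivity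
  have hRt : Tendsto (fun n : ℕ ↦ (n : ℝ) + 1) atTop atTop :=
    tendsto_atTop_add_const_right _ _ tendsto_natCast_atTop_atTop
  choose ρ hρ hM hP using fun n : ℕ ↦ exists_finiteMeasure_circle_poisson hU h0 hC (hR0 n)
    (lt_add_of_pos_right ((n : ℝ) + 1) (inv_pos.2 (hR0 n)))
  have hint : ∀ n, Integrable (fun z : ℂ ↦ 1 + ‖z‖ ^ 2) (ρ n : Measure ℂ) := fun n ↦ by
    obtain ⟨K, hK⟩ := (isCompact_sphere (((n + 1 + (n + 1 : ℝ)⁻¹ : ℝ) : ℂ) * I)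
      ((n : ℝ) + 1)).exists_bound_of_continuousOn
      (f := fun z : ℂ ↦ (1 : ℝ) + ‖z‖ ^ 2) (by fun_prop)
    exact Integrable.of_bound (by fun_prop) K ((hρ n).mono hK)
  obtain ⟨f, ν, hf, hν⟩ := exists_ultrafilter_tendsto_of_integral_one_add_sq_le hint hM
  have hlim := FiniteMeasure.tendsto_iff_forall_integral_tendsto.1 hν
  have hνint := integrable_one_add_sq_of_tendsto hν hint hM
  have hν0 : ∀ᵐ ζ ∂(ν : Measure ℂ), ζ.im = 0 := by
    let b : BoundedContinuousFunction ℂ ℝ :=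
      BoundedContinuousFunction.ofNormedAddCommGroup (fun ζ ↦ |ζ.im| / (1 + ‖ζ‖ ^ 2))
        (Continuous.div (by fun_prop) (by fun_prop) fun ζ ↦ by positivity) 1 fun ζ ↦ by
          rw [Real.norm_of_nonneg (by positivity), div_le_one (by positivity)]
          nlinarith [abs_im_le_norm ζ, sq_nonneg (‖ζ‖ - 1)]
    have hb0 : ∀ ζ, 0 ≤ b ζ := fun ζ ↦
      div_nonneg (abs_nonneg _) (by positivity : (0 : ℝ) ≤ 1 + ‖ζ‖ ^ 2)
    have hle : ∀ n, ∫ ζ, b ζ ∂(ρ n : Measure ℂ) ≤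
        3 / 2 * ((n : ℝ) + 1)⁻¹ * (2 * Real.pi * C) := fun n ↦ by
      have hc : 0 ≤ 3 / 2 * ((n : ℝ) + 1)⁻¹ := by positivity
      refine le_trans ?_ (mul_le_mul_of_nonneg_left (hM n) hc)
      rw [← integral_const_mul]
      refine integral_mono_ae (b.integrable _) ((hint n).const_mul _) ?_
      filter_upwards [hρ n] with ζ hζ
      obtain ⟨h1, h2⟩ := im_le_of_mem_sphere (hR1 n) hζ
      have h3 : b ζ ≤ 3 / 2 * ((n : ℝ) + 1)⁻¹ := by
        change |ζ.im| / (1 + ‖ζ‖ ^ 2) ≤ _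
        rwa [abs_of_nonneg h1]
      exact h3.trans (le_mul_of_one_le_right hc (by nlinarith [sq_nonneg ‖ζ‖]))
    have hz : Tendsto (fun n : ℕ ↦ 3 / 2 * ((n : ℝ) + 1)⁻¹ * (2 * Real.pi * C)) f (𝓝 0) := by
      have := (((tendsto_inv_atTop_zero.comp hRt).const_mul (3 / 2)).mul_const
        (2 * Real.pi * C)).mono_left hf
      simpa using this
    have hi : ∫ ζ, b ζ ∂(ν : Measure ℂ) = 0 :=
      le_antisymm (le_of_tendsto_of_tendsto' (hlim b) hz hle) (integral_nonneg hb0)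
    rw [integral_eq_zero_iff_of_nonneg hb0 (b.integrable _)] at hi
    filter_upwards [hi] with ζ hζ
    have hζ' : |ζ.im| / (1 + ‖ζ‖ ^ 2) = 0 := hζ
    have hne : 1 + ‖ζ‖ ^ 2 ≠ 0 := by positivity
    simpa [hne] using hζ'
  refine ⟨ν, hν0, hνint, fun z hz ↦ ?_⟩
  have hz' : 0 < z.im := hz
  have hk := (tendsto_sq_sub_norm_sub_sq_div z).comp hRt
  -- The prefactor tends to `Im z`, so it eventually exceeds `Im z / 2`. Then `z` is in the disc and
  -- at distance at least `Im z / 2` from the circle, where the kernel agrees with its bounded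
  -- continuous truncation.
  have hev : ∀ᶠ n : ℕ in atTop, U z =
      ((n + 1 : ℝ) ^ 2 - ‖z - (n + 1 + (n + 1 : ℝ)⁻¹ : ℝ) * I‖ ^ 2) / (2 * (n + 1)) *
        (Real.pi⁻¹ * ∫ ζ, truncatedKernel z _ (half_pos hz') ζ ∂(ρ n : Measure ℂ)) := by
    filter_upwards [hk.eventually_const_lt (half_lt_self hz')] with n hn
    simp only [Function.comp_apply] at hn
    have hball : z ∈ ball ((n + 1 + (n + 1 : ℝ)⁻¹ : ℝ) * I : ℂ) ((n : ℝ) + 1) := by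
      have h1 := (half_pos hz').trans hn
      rw [div_pos_iff_of_pos_right (by positivity), sub_pos] at h1
      exact mem_ball_iff_norm.2 (lt_of_pow_lt_pow_left₀ 2 (hR0 n).le h1)
    rw [hP n z hball]
    congr 2
    refine integral_congr_ae ?_
    filter_upwards [hρ n] with ζ hζ
    rw [truncatedKernel_of_le _ (le_norm_sub_of_mem_sphere hball hζ hn.le)]
  have hlimU := (hk.mono_left hf).mul
    ((hlim (truncatedKernel z _ (half_pos hz'))).const_mul Real.pi⁻¹)
  have hU1 := tendsto_nhds_unique
    ((tendsto_const_nhds (x := U z)).congr' (hf hev)) hlimU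
  rw [hU1]
  congr 2
  refine integral_congr_ae ?_
  filter_upwards [hν0] with ζ hζ
  refine truncatedKernel_of_le _ ?_
  have := (neg_le_abs _).trans (abs_im_le_norm (ζ - z))
  rw [sub_im, hζ] at this
  linarith

theorem exists_measure_eq_poissonIntegral {U : ℂ → ℝ} {C : ℝ}
    (hU : InnerProductSpace.HarmonicOnNhd U upperHalf) (h0 : ∀ z ∈ upperHalf, 0 ≤ U z)
    (hC : ∀ z ∈ upperHalf, U z ≤ C / z.im) :
    ∃ μ : Measure ℝ, IsFiniteMeasure μ ∧ ∀ z ∈ upperHalf, U z = poissonIntegral μ z := by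
  obtain ⟨ν, hν0, hint, hP⟩ := exists_finiteMeasure_complex_of_harmonic hU h0 hC
  let κ : Measure ℂ := (ν : Measure ℂ).withDensity fun ζ ↦ ENNReal.ofReal (1 + ‖ζ‖ ^ 2)
  have : IsFiniteMeasure κ := isFiniteMeasure_withDensity_ofReal hint.2
  refine ⟨κ.map re, inferInstance, fun z hz ↦ ?_⟩
  have hk : Continuous fun u ↦ poissonKernelHalf z.im (z.re - u) :=
    (continuous_poissonKernelHalf hz).comp (by fun_prop)
  rw [hP z hz, poissonIntegral, integral_map (by fun_prop) hk.aestronglyMeasurable,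
    integral_withDensity_eq_integral_toReal_smul (by fun_prop) (by simp), ← mul_assoc,
    ← integral_const_mul]
  refine integral_congr_ae ?_
  filter_upwards [hν0] with ζ hζ
  have h1 : ‖ζ - z‖ ^ 2 = (z.re - ζ.re) ^ 2 + z.im ^ 2 := by
    rw [← normSq_eq_norm_sq, normSq_apply, sub_re, sub_im, hζ]
    ring
  rw [ENNReal.toReal_ofReal (by positivity), h1, poissonKernelHalf, smul_eq_mul]
  ring

theorem mainTheorem6 :
    (∀ (U : ℂ → ℝ) (C : ℝ),
      InnerProductSpace.HarmonicOnNhd U upperHalf →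
      (∀ z ∈ upperHalf, 0 ≤ U z) →
      (∀ z ∈ upperHalf, U z ≤ C / z.im) →
      ∃! μ : Measure ℝ, IsFiniteMeasure μ ∧ ∀ z ∈ upperHalf, U z = poissonIntegral μ z) ∧
    (∀ (f : ℂ → ℂ) (C : ℝ),
      DifferentiableOn ℂ f upperHalf →
      (∀ z ∈ upperHalf, 0 ≤ (f z).im) →
      (∀ z ∈ upperHalf, (f z).im ≤ C / z.im) →
      ∃! p : Measure ℝ × ℝ, IsFiniteMeasure p.1 ∧
        ∀ z ∈ upperHalf,
          f z = (1 / (Real.pi : ℂ)) * (∫ u : ℝ, 1 / ((u : ℂ) - z) ∂p.1) + (p.2 : ℂ)) := by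
  refine ⟨fun U C hU h0 hC ↦ ?_, fun f C hf h0 hC ↦ ?_⟩
  · obtain ⟨μ, hμ, hP⟩ := exists_measure_eq_poissonIntegral hU h0 hC
    refine ⟨μ, ⟨hμ, hP⟩, fun ν ⟨hν, hQ⟩ ↦ ?_⟩
    exact eq_of_poissonIntegral_eq fun z hz ↦ (hQ z hz).symm.trans (hP z hz)
  · obtain ⟨μ, hμ, hP⟩ := exists_measure_eq_poissonIntegral
      (fun z hz ↦ (hf.analyticOnNhd isOpen_upperHalf z hz).harmonicAt_im) h0 hC
    obtain ⟨a, ha⟩ := exists_ofReal_eq_of_im_eq_zero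
      (hf.sub ((differentiableOn_integral_one_div_ofReal_sub μ).const_mul (1 / (Real.pi : ℂ))))
      fun z hz ↦ by
        rw [Pi.sub_apply, sub_im, im_integral_one_div_ofReal_sub μ hz, ← hP z hz, sub_self]
    have hrep : ∀ z ∈ upperHalf,
        f z = (1 / (Real.pi : ℂ)) * (∫ u : ℝ, 1 / ((u : ℂ) - z) ∂μ) + (a : ℂ) := fun z hz ↦
      sub_eq_iff_eq_add'.1 (ha z hz)
    refine ⟨(μ, a), ⟨hμ, hrep⟩, ?_⟩
    rintro ⟨ν, b⟩ ⟨hν, hQ⟩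
    have hν' : IsFiniteMeasure ν := hν
    have hνμ : ν = μ := eq_of_poissonIntegral_eq fun z hz ↦ by
      rw [← hP z hz, hQ z hz, add_im, ofReal_im, add_zero, im_integral_one_div_ofReal_sub ν hz]
    -- With equal measures, comparing the two representations at `i` identifies the constants.
    subst hνμ
    have h1 := (hQ I I_mem_upperHalf).symm.trans (hrep I I_mem_upperHalf)
    rw [Prod.mk.injEq]
    exact ⟨rfl, ofReal_injective (add_left_cancel h1)⟩
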